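/- Let $\lambda\in(0,1)$, let $f:[0,\infty)\to[0,\infty)$ be non-decreasing with $f(0)=0$ (staleness cost), and let $p\ge 0$ (update cost) be such that $f(x)\ge p$ for some $x$. Requests arrive according to a Bernoulli($\lambda$) process, and the server decides at each request whether to update its data. This gives the following Markov decision process over request epochs $n=1,2,\dots$. The state $s_n\in\{0,1,2,\dots\}$ is the Age-of-Information (AoI) when the $n$-th request arrives. The action is $a_n=1$ (update) or $a_n=0$ (do not update), and only $a_n=1$ is available when $f(s_n)\ge p$. The cost is $c(s,1)=p$ and $c(s,0)=f(s)$. After action $1$ the next state is $z\ge 1$ with probability $(1-\lambda)^{z-1}\lambda$; after action $0$ in state $s$ it is $z>s$ with probability $(1-\lambda)^{z-s-1}\lambda$. A capped reactive policy chooses each action, possibly at random, as a function of the past states and actions and of the current state, and updates whenever $f(s_n)\ge p$. Then there are a stationary deterministic capped reactive policy $\pi^*$ and an integer threshold $s^*\ge 0$ (with $s^*\ge 1$ if $p>0$) such that $\pi^*$ updates if and only if the AoI is at least $s^*$, and $\pi^*$ is optimal for the long-term average expected cost per request: there is a constant $g\ge 0$ such that, for every initial state $s$, $$\lim_{N\to\infty}\frac1N\,\mathbb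 E_{\pi^*}\Big[\sum_{n=1}^N c(s_n,a_n)\,\Big|\,s_1=s\Big]=g\le\liminf_{N\to\infty}\frac1N\,\mathbb E_{\pi}\Big[\sum_{n=1}^N c(s_n,a_n)\,\Big|\,s_1=s\Big]$$ for every capped reactive policy $\pi$. -/

import Mathlib

open scoped NNReal ENNReal

namespace AoI

/-- The AoI right after the decision taken at a request: `0` if the server updates (`a = true`),
unchanged if it does not. -/
def postAge (s : ℕ) (a : Bool) : ℕ := if a then 0 else s

theorem hasSum_transition {lam : ℝ} (hlam : lam ∈ Set.Ioo (0 : ℝ) 1) (b : ℕ) :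
    HasSum (fun z : ℕ => if b < z then ENNReal.ofReal ((1 - lam) ^ (z - b - 1) * lam) else 0) 1 := by
  have h1 : HasSum (fun k : ℕ => (1 - lam) ^ k * lam) 1 := by
    have h := (hasSum_geometric_of_lt_one (r := 1 - lam) (by linarith [hlam.2])
      (by linarith [hlam.1])).mul_right lam
    have h0 : lam ≠ 0 := hlam.1.ne'
    simpa [h0] using h
  have h2 : HasSum (fun k : ℕ => ENNReal.ofReal ((1 - lam) ^ k * lam)) 1 := by
    have hnn : ∀ k : ℕ, 0 ≤ (1 - lam) ^ k * lam := fun k =>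
      mul_nonneg (pow_nonneg (by linarith [hlam.2]) k) hlam.1.le
    have h := ENNReal.ofReal_tsum_of_nonneg hnn h1.summable
    rw [h1.tsum_eq, ENNReal.ofReal_one] at h
    rw [h]
    exact ENNReal.summable.hasSum
  have hinj : Function.Injective (fun k : ℕ => b + 1 + k) := fun x y h => by
    simpa using h
  refine (hinj.hasSum_iff ?_).mp ?_
  · intro z hz
    have : ¬ b < z := fun hbz => hz ⟨z - (b + 1), by simp only; omega⟩
    simp [this]
  · refine h2.congr_fun ?_
    intro k
    have e : b + 1 + k - b - 1 = k := by omega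
    simp only [Function.comp]
    rw [if_pos (by omega), e]

/-- Transition law of the AoI between consecutive requests when requests arrive according to a
Bernoulli(`lam`) process: after an update the next state is `z ≥ 1` with probability
`(1 - lam) ^ (z - 1) * lam`; without an update it is `z > s` with probability
`(1 - lam) ^ (z - s - 1) * lam`. (For the action "no update" in a state where it is not available
the value is irrelevant, because no capped policy ever takes it.) -/
noncomputable def transition {lam : ℝ} (hlam : lam ∈ Set.Ioo (0 : ℝ) 1) (s : ℕ) (a : Bool) : PMF ℕ :=
  ⟨fun z => if postAge s a < z then ENNReal.ofReal ((1 - lam) ^ (z - postAge s a - 1) * lam) else 0,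
    hasSum_transition hlam (postAge s a)⟩

/-- Cost of one decision epoch: the update cost `p` if the server updates, the staleness cost
`f s` if it does not. -/
def cost (f : ℝ≥0 → ℝ≥0) (p : ℝ≥0) (s : ℕ) (a : Bool) : ℝ≥0 := if a then p else f s

/-- A policy of the decision process over request epochs, possibly randomized and history
dependent: given the past `[(s₁, a₁), …, (sₙ₋₁, aₙ₋₁)]` and the current state `sₙ` it returns the
law of the action `aₙ` (`true` = update). The epoch `n` is the length of the past plus one. -/
abbrev Policy : Type := List (ℕ × Bool) → ℕ → PMF Bool

/-- A capped policy updates (surely) whenever the staleness cost is at least the update cost, i.e.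
it uses only the available actions `{1}` if `f s ≥ p` and `{0, 1}` if `f s < p`. -/
def IsCapped (f : ℝ≥0 → ℝ≥0) (p : ℝ≥0) (π : Policy) : Prop :=
  ∀ (past : List (ℕ × Bool)) (s : ℕ), p ≤ f s → π past s = PMF.pure true

/-- A stationary (deterministic) policy chooses its action as a function of the current state. -/
def IsStationary (π : Policy) : Prop :=
  ∃ d : ℕ → Bool, ∀ (past : List (ℕ × Bool)) (s : ℕ), π past s = PMF.pure (d s)

/-- The policy updates exactly when the AoI is at least `τ`. -/
def HasThreshold (π : Policy) (τ : ℕ) : Prop :=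
  ∀ (past : List (ℕ × Bool)) (s : ℕ), π past s = PMF.pure (decide (τ ≤ s))

/-- Joint law of the history `[(s₁, a₁), …, (sₙ, aₙ)]` of the first `n` epochs and of the state
`sₙ₊₁`, under the policy `π` and with initial state `s₁ = s`. -/
noncomputable def historyLaw {lam : ℝ} (hlam : lam ∈ Set.Ioo (0 : ℝ) 1) (π : Policy) (s : ℕ) :
    ℕ → PMF (List (ℕ × Bool) × ℕ)
  | 0 => PMF.pure ([], s)
  | n + 1 => (historyLaw hlam π s n).bind fun x =>
      (π x.1 x.2).bind fun a =>
        (transition hlam x.2 a).map fun z => (x.1 ++ [(x.2, a)], z)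

/-- The expected total cost `E_π[∑_{n=1}^N c(sₙ, aₙ) | s₁ = s]` of the first `N` requests. -/
noncomputable def expectedCost {lam : ℝ} (hlam : lam ∈ Set.Ioo (0 : ℝ) 1) (f : ℝ≥0 → ℝ≥0)
    (p : ℝ≥0) (π : Policy) (s N : ℕ) : ℝ≥0∞ :=
  ∑' x : List (ℕ × Bool) × ℕ, historyLaw hlam π s N x *
    (((x.1.map fun y => cost f p y.1 y.2).sum : ℝ≥0) : ℝ≥0∞)

/-- The expected cost per request over the first `N` requests. -/
noncomputable def meanCost {lam : ℝ} (hlam : lam ∈ Set.Ioo (0 : ℝ) 1) (f : ℝ≥0 → ℝ≥0)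
    (p : ℝ≥0) (π : Policy) (s N : ℕ) : ℝ≥0∞ :=
  expectedCost hlam f p π s N / N

/-- `π` is average-cost optimal among the capped policies, with long-term average expected cost `g`
for every initial state `s`: the limit of its cost per request exists and equals `g`, and no
capped policy has a smaller long-term average cost, even when measured by the limit inferior (which
is the limit whenever the latter exists). -/
def IsAverageOptimal {lam : ℝ} (hlam : lam ∈ Set.Ioo (0 : ℝ) 1) (f : ℝ≥0 → ℝ≥0) (p : ℝ≥0)
    (π : Policy) (g : ℝ≥0) : Prop :=
  ∀ s : ℕ,
    Filter.Tendsto (meanCost hlam f p π s) Filter.atTop (nhds (g : ℝ≥0∞)) ∧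
    ∀ π' : Policy, IsCapped f p π' →
      (g : ℝ≥0∞) ≤ Filter.liminf (meanCost hlam f p π' s) Filter.atTop

end AoI

namespace AoI

/-! ### A bounded solution of the average-cost optimality equation -/

/-! The average-cost optimality equation has a bounded solution, and a telescoping argument turns it
into optimality. Write `w s = min p (φ s + U s - g)` for the relative value before a decision and `U
b` for the expectation of `w` at the next request from post-decision age `b`. Beyond an age `M` with
`p ≤ φ M` both equal `p`, so for a trial `g` a finite backward recursion determines `U`; continuity
in `g` yields one with `U 0 = g`, which makes the equation `w s + g = min (p + U 0) (φ s + U s)`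
(`exists_optimality_equation`). Since `φ` and `U` are monotone, updating attains the minimum exactly
from some age on. Accumulated cost plus `w` then grows by at least `g` per request in expectation,
and by exactly `g` under the threshold rule; as `0 ≤ w ≤ p`, the effect of `w` vanishes after
division by `N` (`isAverageOptimal_of_optimality_equation`). -/

/-- Backward recursion, from an age `M` at which updating is forced, for the expected relative
value after a decision; `k` is the distance of the post-decision age from `M`. -/
noncomputable def backwardValue (lam p : ℝ) (φ : ℕ → ℝ) (M : ℕ) (g : ℝ) : ℕ → ℝ
  | 0 => p
  | k + 1 => lam * min p (φ (M - k) + backwardValue lam p φ M g k - g) +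
      (1 - lam) * backwardValue lam p φ M g k

theorem continuous_backwardValue (lam p : ℝ) (φ : ℕ → ℝ) (M k : ℕ) :
    Continuous fun g => backwardValue lam p φ M g k := by
  induction k with
  | zero => simpa only [backwardValue] using continuous_const
  | succ k ih =>
    simp only [backwardValue]
    fun_prop

theorem backwardValue_le {lam p : ℝ} (h0 : 0 ≤ lam) (h1 : lam ≤ 1) (φ : ℕ → ℝ) (M : ℕ) (g : ℝ)
    (k : ℕ) : backwardValue lam p φ M g k ≤ p := by
  induction k with
  | zero => simp [backwardValue]
  | succ k ih =>
    simp only [backwardValue]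
    have := mul_le_mul_of_nonneg_left
      (min_le_left p (φ (M - k) + backwardValue lam p φ M g k - g)) h0
    nlinarith [mul_le_mul_of_nonneg_left ih (sub_nonneg.2 h1)]

theorem backwardValue_zero_nonneg {lam p : ℝ} (h0 : 0 ≤ lam) (h1 : lam ≤ 1) (hp : 0 ≤ p)
    {φ : ℕ → ℝ} (hφ : ∀ s, 0 ≤ φ s) (M k : ℕ) : 0 ≤ backwardValue lam p φ M 0 k := by
  induction k with
  | zero => simpa [backwardValue] using hp
  | succ k ih =>
    simp only [backwardValue]
    have hmin : 0 ≤ min p (φ (M - k) + backwardValue lam p φ M 0 k - 0) :=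
      le_min hp (by linarith [hφ (M - k)])
    have := sub_nonneg.2 h1
    positivity

/-- Intermediate value theorem for `g` minus the value at age 0: it is at most 0 at `g = 0` and at
least 0 at `g = p`. -/
theorem exists_backwardValue_eq {lam p : ℝ} (h0 : 0 ≤ lam) (h1 : lam ≤ 1) (hp : 0 ≤ p)
    {φ : ℕ → ℝ} (hφ : ∀ s, 0 ≤ φ s) (M : ℕ) :
    ∃ g ∈ Set.Icc 0 p, backwardValue lam p φ M g M = g := by
  have hc : ContinuousOn (fun g => g - backwardValue lam p φ M g M) (Set.Icc 0 p) :=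
    (continuous_id.sub (continuous_backwardValue lam p φ M M)).continuousOn
  obtain ⟨g, hg, h⟩ := intermediate_value_Icc hp hc (show (0 : ℝ) ∈ Set.Icc _ _ from
    ⟨by simpa using backwardValue_zero_nonneg h0 h1 hp hφ M M,
      sub_nonneg.2 (backwardValue_le h0 h1 φ M p M)⟩)
  exact ⟨g, hg, (sub_eq_zero.1 h).symm⟩

/-- The average-cost optimality equation has a solution: an average cost `g`, and an expected
relative value `U` after a decision, which is non-decreasing in the age. -/
theorem exists_optimality_equation {lam p : ℝ} (h0 : 0 ≤ lam) (h1 : lam ≤ 1) (hp : 0 ≤ p)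
    {φ : ℕ → ℝ} (hφ : ∀ s, 0 ≤ φ s) (hmono : Monotone φ) {M : ℕ} (hM : p ≤ φ M) :
    ∃ (g : ℝ) (U : ℕ → ℝ), 0 ≤ g ∧ U 0 = g ∧ Monotone U ∧ (∀ b, M ≤ b → U b = p) ∧
      ∀ b, U b = lam * min p (φ (b + 1) + U (b + 1) - g) + (1 - lam) * U (b + 1) := by
  obtain ⟨g, ⟨hg0, hgp⟩, hg⟩ := exists_backwardValue_eq h0 h1 hp hφ M
  set U : ℕ → ℝ := fun b => backwardValue lam p φ M g (M - b) with hU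
  have htop : ∀ b, M ≤ b → U b = p := fun b hb => by
    simp [hU, Nat.sub_eq_zero_of_le hb, backwardValue]
  have htopmin : ∀ b, M ≤ b → min p (φ b + U b - g) = p := fun b hb => by
    rw [htop b hb]
    exact min_eq_left (by linarith [hmono hb])
  have hrec : ∀ b, U b = lam * min p (φ (b + 1) + U (b + 1) - g) + (1 - lam) * U (b + 1) := by
    intro b
    rcases le_or_gt M b with hb | hb
    · rw [htopmin (b + 1) (by omega), htop b hb, htop (b + 1) (by omega)]
      ring
    · have e1 : M - b = (M - (b + 1)) + 1 := by omega
      have e2 : M - (M - (b + 1)) = b + 1 := by omega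
      simp only [hU]
      rw [e1, backwardValue, e2]
  -- Monotonicity of `U` reduces to `w ≤ U`, by downward induction from `M`: if `w (b+1) ≤ U (b+1)`,
  -- the convex combination `U b` lies between them, so `φ b + U b` increases at this step and `w b
  -- ≤ w (b+1) ≤ U b`.
  have hle : ∀ k b, M ≤ b + k → min p (φ b + U b - g) ≤ U b := by
    intro k
    induction k with
    | zero =>
      intro b hb
      rw [htopmin b hb, htop b hb]
    | succ k ih =>
      intro b hb
      have h := ih (b + 1) (by omega)
      have hr := hrec b
      have h2 : min p (φ (b + 1) + U (b + 1) - g) ≤ U b := by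
        nlinarith [mul_nonneg (sub_nonneg.2 h1) (sub_nonneg.2 h)]
      have h3 : U b ≤ U (b + 1) := by nlinarith [mul_nonneg h0 (sub_nonneg.2 h)]
      refine le_trans (min_le_min_left p ?_) h2
      linarith [hmono (Nat.le_succ b)]
  refine ⟨g, U, hg0, by simpa [hU] using hg, monotone_nat_of_le_succ fun b => ?_, htop, hrec⟩
  nlinarith [hrec b, mul_nonneg h0 (sub_nonneg.2 (hle M (b + 1) (by omega)))]

/-! ### Expectations under a probability mass function -/

/-- Expectation of an extended nonnegative function. -/
noncomputable def expect {α : Type*} (q : PMF α) (F : α → ℝ≥0∞) : ℝ≥0∞ := ∑' x, q x * F x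

section expect

variable {α β : Type*}

theorem expect_pure (a : α) (F : α → ℝ≥0∞) : expect (PMF.pure a) F = F a := by
  rw [expect, tsum_eq_single a]
  · simp
  · intro b hb
    simp [PMF.pure_apply, hb]

theorem expect_bind (q : PMF α) (r : α → PMF β) (F : β → ℝ≥0∞) :
    expect (q.bind r) F = expect q fun x => expect (r x) F := by
  simp only [expect, PMF.bind_apply, ← ENNReal.tsum_mul_right, ← ENNReal.tsum_mul_left]
  rw [ENNReal.tsum_comm]
  simp only [mul_assoc]

theorem expect_map (q : PMF α) (m : α → β) (F : β → ℝ≥0∞) :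
    expect (q.map m) F = expect q (F ∘ m) := by
  rw [← PMF.bind_pure_comp, expect_bind]
  simp [expect_pure, Function.comp_def]

theorem expect_add (q : PMF α) (F G : α → ℝ≥0∞) :
    expect q (fun x => F x + G x) = expect q F + expect q G := by
  simp only [expect, mul_add, ENNReal.tsum_add]

theorem expect_const (q : PMF α) (c : ℝ≥0∞) : expect q (fun _ => c) = c := by
  rw [expect, ENNReal.tsum_mul_right, q.tsum_coe, one_mul]

theorem expect_mono (q : PMF α) {F G : α → ℝ≥0∞} (h : ∀ x, F x ≤ G x) :
    expect q F ≤ expect q G :=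
  ENNReal.tsum_le_tsum fun x => mul_le_mul_right (h x) _

end expect

/-! ### Expectations of the next state -/

section transition

variable {lam : ℝ} (hlam : lam ∈ Set.Ioo (0 : ℝ) 1)

theorem transition_apply (s : ℕ) (a : Bool) (z : ℕ) :
    transition hlam s a z =
      if postAge s a < z then ENNReal.ofReal ((1 - lam) ^ (z - postAge s a - 1) * lam) else 0 :=
  rfl

theorem transition_eq_false (s : ℕ) (a : Bool) :
    transition hlam s a = transition hlam (postAge s a) false := by
  ext z
  cases a <;> simp [transition_apply, postAge]

/-- Memorylessness of the geometric law: a request comes in the next slot with probability `lam`;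
otherwise the wait restarts from age `b + 1`. -/
theorem transition_false_apply_succ (b z : ℕ) :
    transition hlam b false z = ENNReal.ofReal lam * (if z = b + 1 then 1 else 0) +
      ENNReal.ofReal (1 - lam) * transition hlam (b + 1) false z := by
  simp only [transition_apply, postAge, Bool.false_eq_true, if_false]
  rcases lt_trichotomy z (b + 1) with hz | rfl | hz
  · rw [if_neg (by omega), if_neg (by omega), if_neg (by omega)]
    simp
  · simp
  · rw [if_pos (by omega), if_neg (by omega), if_pos hz, mul_zero, zero_add,
      ← ENNReal.ofReal_mul (by linarith [hlam.2])]
    have e : z - b - 1 = (z - (b + 1) - 1) + 1 := by omega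
    rw [e, pow_succ]
    congr 1
    ring

theorem expect_transition_false_succ (b : ℕ) (F : ℕ → ℝ≥0∞) :
    expect (transition hlam b false) F = ENNReal.ofReal lam * F (b + 1) +
      ENNReal.ofReal (1 - lam) * expect (transition hlam (b + 1) false) F := by
  have h : ∀ z, transition hlam b false z * F z =
      ENNReal.ofReal lam * (if z = b + 1 then F (b + 1) else 0) +
        ENNReal.ofReal (1 - lam) * (transition hlam (b + 1) false z * F z) := by
    intro z
    rw [transition_false_apply_succ hlam, add_mul, mul_assoc, mul_assoc]
    congr 2
    split_ifs with hz <;> simp [hz]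
  simp only [expect, h, ENNReal.tsum_add, ENNReal.tsum_mul_left, tsum_ite_eq]

/-- A function solving the one-slot recursion for the expectation of `w` at the next request, and
equal to it at large ages, is that expectation. -/
theorem expect_transition_eq {w U : ℕ → ℝ} {c : ℝ} {M : ℕ} (hw0 : ∀ s, 0 ≤ w s)
    (hU0 : ∀ b, 0 ≤ U b) (hwM : ∀ s, M ≤ s → w s = c) (hUM : ∀ b, M ≤ b → U b = c)
    (hrec : ∀ b, U b = lam * w (b + 1) + (1 - lam) * U (b + 1)) (s : ℕ) (a : Bool) :
    expect (transition hlam s a) (fun z => ENNReal.ofReal (w z)) =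
      ENNReal.ofReal (U (postAge s a)) := by
  rw [transition_eq_false]
  generalize postAge s a = b
  have key : ∀ k b, M ≤ b + k →
      expect (transition hlam b false) (fun z => ENNReal.ofReal (w z)) = ENNReal.ofReal (U b) := by
    intro k
    induction k with
    | zero =>
      intro b hb
      rw [hUM b hb, ← expect_const (transition hlam b false) (ENNReal.ofReal c)]
      refine tsum_congr fun z => ?_
      rcases lt_or_ge b z with hz | hz
      · simp only [hwM z (by omega)]
      -- Ages `z ≤ b`, where `w` may differ from `c`, carry no mass.
      · simp [transition_apply, postAge, not_lt.2 hz]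
    | succ k ih =>
      intro b hb
      have h1 : 0 ≤ 1 - lam := by linarith [hlam.2]
      rw [expect_transition_false_succ, ih (b + 1) (by omega), hrec b,
        ENNReal.ofReal_add (mul_nonneg hlam.1.le (hw0 _)) (mul_nonneg h1 (hU0 _)),
        ENNReal.ofReal_mul hlam.1.le, ENNReal.ofReal_mul h1]
  exact key M b (by omega)

end transition

/-! ### Accumulated cost plus relative value -/

section verification

variable {lam : ℝ} (hlam : lam ∈ Set.Ioo (0 : ℝ) 1) (f : ℝ≥0 → ℝ≥0) (p : ℝ≥0)

/-- The expected total cost of the first `N` epochs plus the expected value of `w` at the state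
reached. -/
noncomputable def potential (π : Policy) (s : ℕ) (w : ℕ → ℝ≥0∞) (N : ℕ) : ℝ≥0∞ :=
  expect (historyLaw hlam π s N) fun x =>
    (((x.1.map fun y => cost f p y.1 y.2).sum : ℝ≥0) : ℝ≥0∞) + w x.2

theorem potential_zero (π : Policy) (s : ℕ) (w : ℕ → ℝ≥0∞) :
    potential hlam f p π s w 0 = w s := by
  simp [potential, historyLaw, expect_pure]

theorem potential_eq (π : Policy) (s : ℕ) (w : ℕ → ℝ≥0∞) (N : ℕ) :
    potential hlam f p π s w N =
      expectedCost hlam f p π s N + expect (historyLaw hlam π s N) fun x => w x.2 :=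
  expect_add _ _ _

theorem potential_succ (π : Policy) (s : ℕ) (w : ℕ → ℝ≥0∞) (N : ℕ) :
    potential hlam f p π s w (N + 1) =
      expect (historyLaw hlam π s N) fun x =>
        (((x.1.map fun y => cost f p y.1 y.2).sum : ℝ≥0) : ℝ≥0∞) +
          expect (π x.1 x.2) fun a => (cost f p x.2 a : ℝ≥0∞) + expect (transition hlam x.2 a) w := by
  simp only [potential, historyLaw, expect_bind, expect_map, Function.comp_def, List.map_append,
    List.sum_append, List.map_cons, List.map_nil, List.sum_cons, List.sum_nil, add_zero,
    ENNReal.coe_add, expect_add, expect_const, add_assoc]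

theorem potential_add_const (π : Policy) (s : ℕ) (w : ℕ → ℝ≥0∞) (N : ℕ) (g : ℝ≥0∞) :
    potential hlam f p π s w N + g = expect (historyLaw hlam π s N) fun x =>
      (((x.1.map fun y => cost f p y.1 y.2).sum : ℝ≥0) : ℝ≥0∞) + (w x.2 + g) := by
  simp only [← add_assoc]
  rw [expect_add _ _ fun _ => g, expect_const]
  rfl

/-- If `w` satisfies the optimality inequality for every action, the potential of any policy grows
at least linearly. -/
theorem le_potential {w : ℕ → ℝ≥0∞} {g : ℝ≥0∞}
    (h : ∀ s a, w s + g ≤ cost f p s a + expect (transition hlam s a) w) (π : Policy) (s N : ℕ) :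
    w s + N * g ≤ potential hlam f p π s w N := by
  induction N with
  | zero => simp [potential_zero]
  | succ N ih =>
    calc w s + (N + 1 : ℕ) * g = (w s + N * g) + g := by push_cast; ring
      _ ≤ potential hlam f p π s w N + g := by gcongr
      _ ≤ _ := by
        rw [potential_add_const, potential_succ]
        refine expect_mono _ fun x => ?_
        gcongr
        calc w x.2 + g = expect (π x.1 x.2) fun _ => w x.2 + g := (expect_const _ _).symm
          _ ≤ _ := expect_mono _ fun a => h x.2 a

/-- If the actions of a stationary policy attain equality, its potential grows linearly. -/
theorem potential_eq_of_stationary {w : ℕ → ℝ≥0∞} {g : ℝ≥0∞} {d : ℕ → Bool}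
    (h : ∀ s, w s + g = cost f p s (d s) + expect (transition hlam s (d s)) w) (s N : ℕ) :
    potential hlam f p (fun _ s => PMF.pure (d s)) s w N = w s + N * g := by
  induction N with
  | zero => simp [potential_zero]
  | succ N ih =>
    rw [potential_succ]
    simp only [expect_pure, ← h]
    rw [← potential_add_const, ih]
    push_cast
    ring

theorem expectedCost_add_le {w : ℕ → ℝ≥0∞} {C : ℝ≥0∞} (hC : ∀ s, w s ≤ C) (π : Policy)
    (s N : ℕ) : potential hlam f p π s w N ≤ expectedCost hlam f p π s N + C := by
  rw [potential_eq]
  gcongr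
  calc expect (historyLaw hlam π s N) (fun x => w x.2)
      ≤ expect (historyLaw hlam π s N) fun _ => C := expect_mono _ fun x => hC x.2
    _ = C := expect_const _ C

theorem tendsto_sub_const_div (g C : ℝ≥0) :
    Filter.Tendsto (fun N : ℕ => (g : ℝ≥0∞) - C / N) Filter.atTop (nhds (g : ℝ≥0∞)) := by
  have h : Filter.Tendsto (fun N : ℕ => (C : ℝ≥0∞) / N) Filter.atTop (nhds 0) := by
    simpa [div_eq_mul_inv] using
      ENNReal.Tendsto.const_mul ENNReal.tendsto_inv_nat_nhds_zero (Or.inr ENNReal.coe_ne_top)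
  simpa using ENNReal.Tendsto.sub tendsto_const_nhds h (Or.inl ENNReal.coe_ne_top)

theorem tendsto_add_const_div (g C : ℝ≥0) :
    Filter.Tendsto (fun N : ℕ => (C : ℝ≥0∞) / N + g) Filter.atTop (nhds (g : ℝ≥0∞)) := by
  have h : Filter.Tendsto (fun N : ℕ => (C : ℝ≥0∞) / N) Filter.atTop (nhds 0) := by
    simpa [div_eq_mul_inv] using
      ENNReal.Tendsto.const_mul ENNReal.tendsto_inv_nat_nhds_zero (Or.inr ENNReal.coe_ne_top)
  simpa using h.add (tendsto_const_nhds (x := (g : ℝ≥0∞)))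

/-- In the linear lower bound for the potential, the initial `w s` is dropped and the terminal value
costs at most `C`. -/
theorem sub_div_le_meanCost {w : ℕ → ℝ≥0∞} {g C : ℝ≥0} (hC : ∀ s, w s ≤ C)
    (h : ∀ s a, w s + g ≤ cost f p s a + expect (transition hlam s a) w) (π : Policy) (s : ℕ)
    {N : ℕ} (hN : N ≠ 0) : (g : ℝ≥0∞) - C / N ≤ meanCost hlam f p π s N := by
  have hN0 : (N : ℝ≥0∞) ≠ 0 := by exact_mod_cast hN
  have hle : N * (g : ℝ≥0∞) ≤ expectedCost hlam f p π s N + C :=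
    (le_add_self.trans (le_potential hlam f p h π s N)).trans
      (expectedCost_add_le hlam f p hC π s N)
  rw [tsub_le_iff_right, meanCost, ← ENNReal.add_div,
    ENNReal.le_div_iff_mul_le (Or.inl hN0) (Or.inl (ENNReal.natCast_ne_top N)), mul_comm]
  exact hle

/-- Verification theorem: a stationary policy attaining the minimum in the optimality equation with
bounded relative value is average-cost optimal. -/
theorem isAverageOptimal_of_optimality_equation {w : ℕ → ℝ≥0∞} {g C : ℝ≥0} (hC : ∀ s, w s ≤ C)
    (h : ∀ s a, w s + g ≤ cost f p s a + expect (transition hlam s a) w) {d : ℕ → Bool}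
    (hd : ∀ s, w s + g = cost f p s (d s) + expect (transition hlam s (d s)) w) :
    IsAverageOptimal hlam f p (fun _ s => PMF.pure (d s)) g := by
  intro s
  have hev : ∀ π : Policy, ∀ᶠ N : ℕ in Filter.atTop,
      (g : ℝ≥0∞) - C / N ≤ meanCost hlam f p π s N := fun π => by
    filter_upwards [Filter.eventually_ne_atTop 0] with N hN
    exact sub_div_le_meanCost hlam f p hC h π s hN
  refine ⟨tendsto_of_tendsto_of_tendsto_of_le_of_le' (tendsto_sub_const_div g C)
    (tendsto_add_const_div g C) (hev _) ?_, fun π' _ => ?_⟩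
  · filter_upwards [Filter.eventually_ne_atTop 0] with N hN
    have hN0 : (N : ℝ≥0∞) ≠ 0 := by exact_mod_cast hN
    have hle : expectedCost hlam f p (fun _ s => PMF.pure (d s)) s N ≤ C + N * g := by
      refine le_trans ?_ (add_le_add_left (hC s) _)
      rw [← potential_eq_of_stationary hlam f p hd s N, potential_eq]
      exact le_self_add
    rw [meanCost]
    refine (ENNReal.div_le_div_right hle _).trans (le_of_eq ?_)
    rw [ENNReal.add_div, ENNReal.mul_div_right_comm,
      ENNReal.div_self hN0 (ENNReal.natCast_ne_top N), one_mul]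
  · rw [← (tendsto_sub_const_div g C).liminf_eq]
    exact Filter.liminf_le_liminf (hev π')

end verification

/-- A non-decreasing sequence that reaches the level `c` is at least `c` exactly from some index
on. -/
theorem exists_threshold {v : ℕ → ℝ} (hv : Monotone v) {c : ℝ} (hc : ∃ s, c ≤ v s) :
    ∃ τ : ℕ, (∀ s, τ ≤ s ↔ c ≤ v s) := by
  classical
  exact ⟨Nat.find hc, fun s =>
    ⟨fun h => (Nat.find_spec hc).trans (hv h), fun h => Nat.find_min' hc h⟩⟩

end AoI

theorem theorem1 (lam : ℝ) (hlam : lam ∈ Set.Ioo (0 : ℝ) 1)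
    (f : ℝ≥0 → ℝ≥0) (hf : Monotone f) (hf0 : f 0 = 0)
    (p : ℝ≥0) (hcap : ∃ x : ℝ≥0, p ≤ f x) :
    ∃ π : AoI.Policy, AoI.IsCapped f p π ∧ AoI.IsStationary π ∧
      (∃ τ : ℕ, (0 < p → 0 < τ) ∧ AoI.HasThreshold π τ) ∧
      ∃ g : ℝ≥0, AoI.IsAverageOptimal hlam f p π g := by
  obtain ⟨x, hx⟩ := hcap
  obtain ⟨M, hM⟩ := exists_nat_ge x
  set φ : ℕ → ℝ := fun s => (f s : ℝ) with hφ
  have hφmono : Monotone φ := fun a b hab => by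
    exact_mod_cast hf (Nat.cast_le.2 hab)
  have hφM : (p : ℝ) ≤ φ M := by exact_mod_cast hx.trans (hf hM)
  have hφ0 : ∀ s, 0 ≤ φ s := fun s => (f s).2
  obtain ⟨g, U, hg, hU0, hU, hUM, hrec⟩ :=
    AoI.exists_optimality_equation hlam.1.le hlam.2.le p.2 hφ0 hφmono hφM
  have hUg : ∀ b, g ≤ U b := fun b => hU0 ▸ hU (Nat.zero_le b)
  have hUnonneg : ∀ b, 0 ≤ U b := fun b => hg.trans (hUg b)
  obtain ⟨τ, hτ⟩ := AoI.exists_threshold (v := fun s => φ s + U s - g) (c := p)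
    (fun a b hab => sub_le_sub_right (add_le_add (hφmono hab) (hU hab)) g)
    ⟨M, by linarith [hUg M]⟩
  set w : ℕ → ℝ := fun s => min (p : ℝ) (φ s + U s - g) with hw
  have hw0 : ∀ s, 0 ≤ w s := fun s => le_min p.2 (by linarith [hφ0 s, hUg s])
  have hwM : ∀ s, M ≤ s → w s = p := fun s hs =>
    min_eq_left (by linarith [hφmono hs, hUg s])
  have hE := AoI.expect_transition_eq hlam hw0 hUnonneg hwM hUM hrec
  -- With both sides of the optimality equation written as `ENNReal.ofReal` of a real number, its
  -- verification becomes real arithmetic.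
  have hstep : ∀ s a, (AoI.cost f p s a : ℝ≥0∞) +
      AoI.expect (AoI.transition hlam s a) (fun z => ENNReal.ofReal (w z)) =
      ENNReal.ofReal (AoI.cost f p s a + U (AoI.postAge s a)) := fun s a => by
    rw [hE, ENNReal.ofReal_add (NNReal.coe_nonneg _) (hUnonneg _), ENNReal.ofReal_coe_nnreal]
  have hwg : ∀ s, ENNReal.ofReal (w s) + (g.toNNReal : ℝ≥0∞) = ENNReal.ofReal (w s + g) :=
    fun s => (ENNReal.ofReal_add (hw0 s) hg).symm
  refine ⟨fun _ s => PMF.pure (decide (τ ≤ s)), fun _ s hs => ?_, ⟨_, fun _ _ => rfl⟩,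
    ⟨τ, fun hp => ?_, fun _ _ => rfl⟩, g.toNNReal,
    AoI.isAverageOptimal_of_optimality_equation hlam f p
      (w := fun s => ENNReal.ofReal (w s)) (C := p) (fun s => ?_) (fun s a => ?_)
      (d := fun s => decide (τ ≤ s)) (fun s => ?_)⟩
  -- Since `U s ≥ g`, a staleness cost of at least `p` already puts `s` at or above the threshold.
  · have hs' : (p : ℝ) ≤ φ s := by exact_mod_cast hs
    exact congrArg PMF.pure (decide_eq_true ((hτ s).2 (by linarith [hUg s])))
  -- At age 0, `φ 0 + U 0 - g = 0`, which is below `p` when `p > 0`.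
  · by_contra h
    have h2 := (hτ 0).1 (by omega)
    have h3 : φ 0 = 0 := by simp [hφ, hf0]
    have hp' : (0 : ℝ) < p := by exact_mod_cast hp
    linarith
  · exact (ENNReal.ofReal_le_ofReal (min_le_left _ _)).trans ENNReal.ofReal_coe_nnreal.le
  · rw [hstep, hwg]
    refine ENNReal.ofReal_le_ofReal ?_
    cases a
    · have : w s ≤ φ s + U s - g := min_le_right _ _
      simp only [AoI.cost, AoI.postAge, Bool.false_eq_true, if_false]
      linarith
    · have : w s ≤ p := min_le_left _ _
      simp only [AoI.cost, AoI.postAge, if_true, hU0]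
      linarith
  · rw [hstep, hwg]
    congr 1
    by_cases hs : τ ≤ s
    · have : w s = p := min_eq_left ((hτ s).1 hs)
      simp [AoI.cost, AoI.postAge, hs, hU0, this]
    · have : w s = φ s + U s - g := min_eq_right (not_le.1 fun h => hs ((hτ s).2 h)).le
      simp [AoI.cost, AoI.postAge, hs, this, hφ]
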